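/- Let $G$ be any locally compact (Hausdorff) topological group with a left Haar measure $\mu$, and let $\mu^*$ be the corresponding outer measure. Call a subset of $G$ Haar measurable if it is measurable in the sense of Carathéodory with respect to $\mu^*$. Let $H$ be a complex Hilbert space of arbitrary dimension and let $U$ be a unitary representation of $G$ on $H$, that is, a group homomorphism from $G$ to the group of unitary operators on $H$ (no continuity is assumed). Let $\mathcal L(H)$ be the space of bounded linear operators on $H$ with the weak operator topology. If $U$ is measurable as a map from $G$ to $\mathcal L(H)$, that is, if $U^{-1}(V)$ is Haar measurable for every open set $V\subset\mathcal L(H)$, then $U$ is continuous, that is, for all $x,y\in H$ the coefficient $t\mapsto\langle U(t)x,y\rangle$ is a continuous function on $G$. -/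

import Mathlib

open MeasureTheory

/-- A subset of a locally compact group is *Haar measurable* if it is measurable in the sense of
Carathéodory for the outer measure `μ*` of the Haar measure `μ`. A Mathlib measure on the Borel
sets, applied to an arbitrary set, is this outer measure. The Haar measurable sets contain the Borel
sets, the null sets and, for groups that are not `σ`-compact, also the locally null sets. -/
def HaarMeasurableSet {G : Type*} [MeasurableSpace G] (μ : Measure G) (s : Set G) : Prop :=
  μ.toOuterMeasure.IsCaratheodory s

/-- A unitary representation `U` of `G` on `H` (a homomorphism into the unitary operators) is
*weakly operator measurable* if the preimage of every set of bounded operators that is open in the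
weak operator topology is Haar measurable. -/
def WeaklyOperatorMeasurable {G H : Type*} [Group G] [MeasurableSpace G]
    [NormedAddCommGroup H] [InnerProductSpace ℂ H] [CompleteSpace H]
    (μ : Measure G) (U : G →* unitary (H →L[ℂ] H)) : Prop :=
  ∀ V : Set (H →WOT[ℂ] H), IsOpen V →
    HaarMeasurableSet μ {t : G | ContinuousLinearMapWOT.ofCLM (U t : H →L[ℂ] H) ∈ V}

/-- A unitary representation is *continuous* if all its coefficients are. The
inner product `⟨U(t)x, y⟩`, linear in the first argument, is `inner ℂ y (U t x)` in Mathlib. -/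
def IsContinuousRep {G H : Type*} [Group G] [TopologicalSpace G]
    [NormedAddCommGroup H] [InnerProductSpace ℂ H] [CompleteSpace H]
    (U : G →* unitary (H →L[ℂ] H)) : Prop :=
  ∀ x y : H, Continuous fun t : G => inner ℂ y ((U t : H →L[ℂ] H) x)

/-! Fix `x` and put F(t) = U(t⁻¹)x. On the sphere of radius ‖x‖, nearness in norm to z is an
inequality on Re⟨x, U(t)z⟩, so F pulls norm-open sets back to Haar measurable sets. If some ball of
radius ε/2 has non-null preimage in a compact neighbourhood of 1, Steinhaus' theorem gives a
neighbourhood of 1 where ‖U(g)x - x‖ < ε.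

As H may be non-separable, finding the ball is the hard part. If all were null, well-ordering the
centres would give, on countably many pieces covering the compact set, a map with null fibres that
pulls every set back to a measurable one. `measure_eq_zero_of_forall_nullMeasurableSet_preimage`
forbids this, by induction on the cardinality of the target. Real-valued maps are excluded by a
Bernstein set and Lusin's theorem, so the image measure has an atom. By induction its null sets are
closed under unions of fewer sets than the cardinality of the target, and compactness contradicts
this. -/

/-! ### Bernstein sets -/

open Cardinal in
-- Transfinite recursion along a well-order of least type: fewer than `#α` values are used before
-- each stage, so `P a` is never exhausted.
theorem exists_injective_selector {α Y : Type u} (P : α → Set Y) (hP : ∀ a, #α ≤ #(P a)) :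
    ∃ s : α → Y, Function.Injective s ∧ ∀ a, s a ∈ P a := by
  obtain ⟨r, hr, hord⟩ := exists_ord_eq α
  have key : ∀ (a : α) (g : ∀ b, r b a → Y), ∃ y ∈ P a, ∀ b hb, g b hb ≠ y := by
    intro a g
    by_contra! hcon
    have hsub : P a ⊆ Set.range fun b : {b // r b a} => g b.1 b.2 := by
      intro y hy
      obtain ⟨b, hb, h⟩ := hcon y hy
      exact ⟨⟨b, hb⟩, h⟩
    have h1 : #(P a) ≤ #{b // r b a} := (mk_le_mk_of_subset hsub).trans mk_range_le
    have h2 : #{b // r b a} < #α := (Ordinal.card_typein (r := r) a).symm.trans_lt (card_typein_lt a hord)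
    exact absurd (hP a) (not_le.2 (h1.trans_lt h2))
  choose c hcP hc using key
  have hwf : WellFounded r := hr.toIsWellFounded.wf
  let s : α → Y := hwf.fix c
  have hs : ∀ a, s a = c a fun b _ => s b := fun a => hwf.fix_eq c a
  have hne : ∀ a b, r b a → s b ≠ s a := by
    intro a b hb
    rw [hs a]
    exact hc a (fun b _ => s b) b hb
  refine ⟨s, fun a b hab => ?_, fun a => ?_⟩
  · rcases trichotomous_of r a b with h | h | h
    · exact absurd hab (hne _ _ h)
    · exact h
    · exact absurd hab.symm (hne _ _ h)
  · rw [hs a]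
    exact hcP _ _

open Cardinal in
/-- A Bernstein set. -/
theorem exists_forall_isClosed_countable :
    ∃ D : Set ℝ, ∀ L : Set ℝ, IsClosed L → L ⊆ D ∨ L ⊆ Dᶜ → L.Countable := by
  let C := {L : Set ℝ // IsClosed L ∧ ¬ L.Countable}
  have hC : #C ≤ 𝔠 := by
    obtain ⟨b, hb, -, hbas⟩ := TopologicalSpace.exists_countable_basis ℝ
    have hb' : #b ≤ 𝔠 := (le_aleph0_iff_set_countable.2 hb).trans aleph0_le_continuum
    have h := MeasurableSpace.cardinal_measurableSet_le_continuum hb'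
    rw [← hbas.borel_eq_generateFrom] at h
    refine le_trans (mk_le_of_injective
      (f := fun L : C => (⟨L.1, ?_⟩ : {t : Set ℝ | MeasurableSet[borel ℝ] t})) ?_) h
    · rw [← BorelSpace.measurable_eq (α := ℝ)]
      exact L.2.1.measurableSet
    · intro L L' h
      exact Subtype.ext (Subtype.mk.inj h)
  have hP : ∀ a : C × Bool, #(C × Bool) ≤ #(a.1.1 : Set ℝ) := by
    rintro ⟨⟨L, hL, hL'⟩, -⟩
    obtain ⟨g, hg, -, hgi⟩ := hL.exists_nat_bool_injection_of_not_countable hL'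
    have h1 : #(ℕ → Bool) ≤ #L := mk_le_of_injective
      (f := fun x => (⟨g x, hg ⟨x, rfl⟩⟩ : L)) fun x y h => hgi (congrArg Subtype.val h)
    have h2 : #(ℕ → Bool) = 𝔠 := by simp
    rw [h2] at h1
    refine le_trans ?_ h1
    rw [mk_prod, lift_id, lift_id]
    exact (mul_le_mul' hC (by simpa using (nat_lt_continuum 2).le)).trans continuum_mul_self.le
  obtain ⟨s, hs, hsP⟩ := exists_injective_selector (fun a : C × Bool => a.1.1) hP
  -- Each uncountable closed set receives two points: the `true` one lies in `D`, the `false` one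
  -- outside by injectivity.
  refine ⟨Set.range fun L => s (L, true), fun L hL h => ?_⟩
  by_contra hcon
  rcases h with h | h
  · obtain ⟨L', hL'⟩ := h (hsP (⟨L, hL, hcon⟩, false))
    simpa using hs hL'
  · exact h (hsP (⟨L, hL, hcon⟩, true)) ⟨_, rfl⟩

/-! ### Lusin's theorem and real-valued maps -/

theorem MeasureTheory.NullMeasurableSet.exists_isCompact_sdiff_lt {X : Type*} [TopologicalSpace X]
    [T2Space X] [MeasurableSpace X] [BorelSpace X] {μ : Measure X} [IsFiniteMeasure μ]
    [μ.InnerRegularCompactLTTop] {S : Set X} (hS : NullMeasurableSet S μ) {ε : ENNReal}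
    (hε : ε ≠ 0) : ∃ K ⊆ S, IsCompact K ∧ μ (S \ K) < ε := by
  obtain ⟨T, hTS, hT, hae⟩ := hS.exists_measurable_subset_ae_eq
  obtain ⟨K, hKT, hK, hlt⟩ := hT.exists_isCompact_sdiff_lt (measure_ne_top μ T) hε
  refine ⟨K, hKT.trans hTS, hK, ?_⟩
  rwa [← measure_congr (hae.diff (ae_eq_refl K))]

/-- For each basic open set, compact sets inside its preimage and inside the complement miss at most
`δ i`. These losses sum to less than `μ S`, and on what remains each preimage is relatively open. -/
theorem exists_isCompact_continuousOn {X Y : Type*} [TopologicalSpace X]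
    [T2Space X] [MeasurableSpace X] [BorelSpace X] {μ : Measure X} [IsFiniteMeasure μ]
    [μ.InnerRegularCompactLTTop] [TopologicalSpace Y] [SecondCountableTopology Y]
    {h : X → Y} (hh : ∀ O, IsOpen O → NullMeasurableSet (h ⁻¹' O) μ)
    {S : Set X} (hS : NullMeasurableSet S μ) (hpos : μ S ≠ 0) :
    ∃ L ⊆ S, IsCompact L ∧ μ L ≠ 0 ∧ ContinuousOn h L := by
  obtain ⟨b, hb, -, hbas⟩ := TopologicalSpace.exists_countable_basis Y
  have := hb.to_subtype
  obtain ⟨δ, hδ, hsum⟩ := ENNReal.exists_pos_sum_of_countable' hpos b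
  have key : ∀ i : b, ∃ A C : Set X, IsCompact A ∧ IsCompact C ∧ A ⊆ h ⁻¹' i ∧
      C ⊆ (h ⁻¹' i)ᶜ ∧ μ (A ∪ C)ᶜ ≤ δ i := by
    intro i
    have hi := hh i (hbas.isOpen i.2)
    have h2 : δ i / 2 ≠ 0 := (ENNReal.half_pos (hδ i).ne').ne'
    obtain ⟨A, hA, hAc, hAlt⟩ := hi.exists_isCompact_sdiff_lt h2
    obtain ⟨C, hC, hCc, hClt⟩ := hi.compl.exists_isCompact_sdiff_lt h2
    refine ⟨A, C, hAc, hCc, hA, hC, ?_⟩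
    calc μ (A ∪ C)ᶜ ≤ μ ((h ⁻¹' i \ A) ∪ ((h ⁻¹' i)ᶜ \ C)) := by
          refine measure_mono fun x hx => ?_
          simp only [Set.mem_compl_iff, Set.mem_union, not_or] at hx
          by_cases hxi : x ∈ h ⁻¹' (i : Set Y)
          · exact Or.inl ⟨hxi, hx.1⟩
          · exact Or.inr ⟨hxi, hx.2⟩
      _ ≤ δ i / 2 + δ i / 2 := (measure_union_le _ _).trans (add_le_add hAlt.le hClt.le)
      _ = δ i := ENNReal.add_halves _
  choose A C hA hC hAi hCi hμ using key
  let T := S ∩ ⋂ i, (A i ∪ C i)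
  have hT : NullMeasurableSet T μ := hS.inter <| NullMeasurableSet.iInter fun i =>
    ((hA i).union (hC i)).measurableSet.nullMeasurableSet
  have hTpos : μ T ≠ 0 := by
    intro h0
    have h1 : S ⊆ T ∪ ⋃ i, (A i ∪ C i)ᶜ := by
      intro x hx
      by_cases hxi : x ∈ ⋂ i, (A i ∪ C i)
      · exact Or.inl ⟨hx, hxi⟩
      · rw [← Set.compl_iInter]
        exact Or.inr hxi
    have h2 : μ S ≤ ∑' i, δ i :=
      calc μ S ≤ μ T + μ (⋃ i, (A i ∪ C i)ᶜ) := (measure_mono h1).trans (measure_union_le _ _)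
        _ ≤ ∑' i, δ i := by
          rw [h0, zero_add]
          exact (measure_iUnion_le _).trans (ENNReal.tsum_le_tsum hμ)
    exact absurd h2 (not_le.2 hsum)
  obtain ⟨L, hLT, hL, hlt⟩ := hT.exists_isCompact_sdiff_lt hTpos
  refine ⟨L, hLT.trans Set.inter_subset_left, hL, fun h0 => ?_, fun x hx => ?_⟩
  · rw [measure_sdiff_null h0] at hlt
    exact hlt.false
  · refine (hbas.nhds_hasBasis (a := h x)).tendsto_right_iff.2 ?_
    rintro i ⟨hib, hxi⟩
    have hxC : x ∉ C ⟨i, hib⟩ := fun hxC => hCi ⟨i, hib⟩ hxC hxi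
    filter_upwards [mem_nhdsWithin_of_mem_nhds ((hC ⟨i, hib⟩).isClosed.isOpen_compl.mem_nhds hxC),
      self_mem_nhdsWithin] with y hyC hyL
    rcases Set.mem_iInter.1 (hLT hyL).2 ⟨i, hib⟩ with hyA | hyC'
    · exact hAi ⟨i, hib⟩ hyA
    · exact absurd hyC' hyC

/-- A non-null preimage of a Bernstein set or its complement would contain a non-null compact set
with compact, hence countable, image: a countable union of null fibres. -/
theorem measure_eq_zero_of_forall_nullMeasurableSet_preimage_real {X : Type*} [TopologicalSpace X]
    [T2Space X] [MeasurableSpace X] [BorelSpace X] {μ : Measure X} [IsFiniteMeasure μ]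
    [μ.InnerRegularCompactLTTop] {h : X → ℝ} (hh : ∀ D, NullMeasurableSet (h ⁻¹' D) μ)
    (hfib : ∀ c, μ (h ⁻¹' {c}) = 0) : μ = 0 := by
  obtain ⟨D, hD⟩ := exists_forall_isClosed_countable
  have key : ∀ E : Set ℝ, E = D ∨ E = Dᶜ → μ (h ⁻¹' E) = 0 := by
    intro E hE
    by_contra hpos
    obtain ⟨L, hLE, hL, hL0, hcont⟩ :=
      exists_isCompact_continuousOn (fun O _ => hh O) (hh E) hpos
    have hc : (h '' L).Countable := by
      refine hD _ (hL.image_of_continuousOn hcont).isClosed ?_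
      have hsub : h '' L ⊆ E := Set.image_subset_iff.2 hLE
      rcases hE with rfl | rfl
      · exact Or.inl hsub
      · exact Or.inr hsub
    refine hL0 (measure_mono_null (Set.subset_preimage_image h L) ?_)
    rw [← Set.biUnion_of_singleton (h '' L), Set.preimage_iUnion₂]
    exact (measure_biUnion_null_iff hc).2 fun c _ => hfib c
  rw [← Measure.measure_univ_eq_zero, ← Set.union_compl_self (h ⁻¹' D)]
  exact measure_union_null (key D (Or.inl rfl)) (key Dᶜ (Or.inr rfl))

/-! ### Atoms of image measures -/

open Cardinal in
theorem exists_injective_seq_real : ∃ e : (ℕ → ℝ) → ℝ, Function.Injective e := by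
  have h : #(ℕ → ℝ) ≤ #ℝ := by simp [mk_real]
  obtain ⟨e⟩ := h
  exact ⟨e, e.injective⟩

/-- The image, on all subsets of `I`, of a measure for which all preimages under `f` are
measurable. -/
theorem exists_measure_top_apply_eq_preimage {X I : Type*} [MeasurableSpace X] [MeasurableSpace I]
    [DiscreteMeasurableSpace I] (μ : Measure X) [IsFiniteMeasure μ] {f : X → I}
    (hf : ∀ S, NullMeasurableSet (f ⁻¹' S) μ) :
    ∃ ν : Measure I, IsFiniteMeasure ν ∧ ∀ S, ν S = μ (f ⁻¹' S) := by
  let g : NullMeasurableSpace X μ → I := f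
  have hm : Measurable g := fun S _ => hf S
  let ν : Measure I := μ.completion.map g
  have key : ∀ S, ν S = μ (f ⁻¹' S) := by
    intro S
    rw [Measure.map_apply hm (MeasurableSet.of_discrete)]
    exact Measure.completion_apply μ _
  refine ⟨ν, ⟨?_⟩, key⟩
  rw [key]
  exact measure_lt_top _ _

/-- The integral `q g` of the measure of the fibre through a point drops when `g` is refined. A
non-null fibre of a minimiser is an atom, since splitting it would lower `q`. -/
theorem exists_atom_of_forall_real {I : Type*} [MeasurableSpace I] [DiscreteMeasurableSpace I]
    (ν : Measure I) [IsFiniteMeasure ν] (hR : ∀ h : I → ℝ, ∃ c, ν (h ⁻¹' {c}) ≠ 0) :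
    ∃ T, ν T ≠ 0 ∧ ∀ R ⊆ T, ν R = 0 ∨ ν (T \ R) = 0 := by
  obtain ⟨e, he⟩ := exists_injective_seq_real
  let q : (I → ℝ) → ENNReal := fun g => ∫⁻ i, ν (g ⁻¹' {g i}) ∂ν
  have hq : ∀ g g' : I → ℝ, (∀ i j, g i = g j → g' i = g' j) → q g ≤ q g' := by
    intro g g' h
    exact lintegral_mono fun i => measure_mono fun j hj => h j i hj
  obtain ⟨u, -, hu, hmem⟩ := exists_seq_tendsto_sInf (Set.range_nonempty q) (OrderBot.bddBelow _)
  choose g hg using hmem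
  -- One real codes a whole minimising sequence, so the infimum is attained.
  let G : I → ℝ := fun i => e fun n => g n i
  have hG : ∀ g', q G ≤ q g' := by
    intro g'
    have h1 : q G ≤ sInf (Set.range q) := ge_of_tendsto' hu fun n => by
      rw [← hg n]
      exact hq _ _ fun i j hij => congrFun (he hij) n
    exact h1.trans (sInf_le ⟨g', rfl⟩)
  obtain ⟨c, hc⟩ := hR G
  refine ⟨_, hc, fun R hR => ?_⟩
  by_contra! hcon
  classical
  let G' : I → ℝ := fun i => e fun n => if n = 0 then G i else if i ∈ R then 1 else 0
  have hG' : ∀ i j, G' i = G' j → G i = G j ∧ (i ∈ R ↔ j ∈ R) := by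
    intro i j hij
    refine ⟨by simpa using congrFun (he hij) 0, ?_⟩
    have := congrFun (he hij) 1
    by_cases hi : i ∈ R <;> by_cases hj : j ∈ R <;> simp_all
  have hlt : q G' < q G := by
    refine lintegral_strict_mono_of_ae_le_of_ae_lt_on (Measurable.of_discrete).aemeasurable ?_
      (ae_of_all _ fun i => measure_mono fun j hj => (hG' j i hj).1) hcon.1
      (ae_of_all _ fun i hi => ?_)
    · refine ne_top_of_le_ne_top ?_ (lintegral_mono fun i => measure_mono (Set.subset_univ _))
      rw [lintegral_const]
      exact ENNReal.mul_ne_top (measure_ne_top _ _) (measure_ne_top _ _)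
    · have hGi : G i = c := hR hi
      have h1 : G' ⁻¹' {G' i} ⊆ R := fun j hj => ((hG' j i hj).2).2 hi
      refine (measure_mono h1).trans_lt ?_
      rw [hGi, ← measure_inter_add_sdiff (G ⁻¹' {c}) (MeasurableSet.of_discrete (s := R)),
        Set.inter_eq_right.2 hR]
      exact ENNReal.lt_add_right (measure_ne_top _ _) hcon.2
  exact absurd (hG G') (not_le.2 hlt)

/-! ### Two-valued image measures and the induction on cardinality -/

open Cardinal in
-- Non-null compact sets `K γ` over the tails `Ioi γ` are averaged to find `#Λ` many with the finite
-- intersection property. A common point `x` puts all their indices below `f x`, where there are too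
-- few.
theorem measure_eq_zero_of_two_valued {X : Type*} [TopologicalSpace X]
    [T2Space X] [MeasurableSpace X] [BorelSpace X] {μ : Measure X} [IsFiniteMeasure μ]
    [μ.InnerRegularCompactLTTop] {Λ : Type u} [LinearOrder Λ] (hΛ : ∀ i : Λ, #(Set.Iio i) < #Λ)
    {f : X → Λ} (hf : ∀ S, NullMeasurableSet (f ⁻¹' S) μ)
    (htwo : ∀ S, μ (f ⁻¹' S) = 0 ∨ μ (f ⁻¹' Sᶜ) = 0)
    (hadd : ∀ (ι : Type u) (N : ι → Set Λ), #ι < #Λ → (∀ i, μ (f ⁻¹' N i) = 0) →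
      μ (f ⁻¹' ⋃ i, N i) = 0)
    (hfib : ∀ i, μ (f ⁻¹' {i}) = 0) : μ = 0 := by
  by_contra hμ
  have huniv : μ Set.univ ≠ 0 := fun h => hμ (Measure.measure_univ_eq_zero.1 h)
  have hinf : Infinite Λ := by
    by_contra h
    have := not_infinite_iff_finite.1 h
    refine huniv ?_
    rw [← Set.preimage_univ (f := f), ← Set.iUnion_of_singleton, Set.preimage_iUnion]
    exact measure_iUnion_null hfib
  have hsmall : ∀ C : Set Λ, #C < #Λ → μ (f ⁻¹' C) = 0 := by
    intro C hC
    have := hadd C (fun i => {i.1}) hC fun i => hfib _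
    rwa [Set.iUnion_singleton_eq_range, Subtype.range_coe] at this
  have hconull : ∀ S, μ (f ⁻¹' S) = 0 → μ (f ⁻¹' Sᶜ) ≠ 0 := by
    intro S hS h
    refine huniv ?_
    rw [← Set.union_compl_self (f ⁻¹' S)]
    exact measure_union_null hS h
  have hK : ∀ γ : Λ, ∃ K ⊆ f ⁻¹' Set.Ioi γ, IsCompact K ∧ μ K ≠ 0 := by
    intro γ
    have h1 : #(Set.Iic γ) < #Λ := by
      rw [← Set.Iio_insert]
      exact mk_insert_le.trans_lt (add_lt_of_lt (aleph0_le_mk Λ) (hΛ γ)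
        (one_lt_aleph0.trans_le (aleph0_le_mk Λ)))
    have h2 : μ (f ⁻¹' Set.Ioi γ) ≠ 0 := by
      rw [← Set.compl_Iic]
      exact hconull _ (hsmall _ h1)
    obtain ⟨K, hKs, hKc, hlt⟩ := (hf (Set.Ioi γ)).exists_isCompact_sdiff_lt h2
    refine ⟨K, hKs, hKc, fun h0 => ?_⟩
    rw [measure_sdiff_null h0] at hlt
    exact hlt.false
  choose K hKf hKc hKpos using hK
  let _ : MeasurableSpace Λ := ⊤
  obtain ⟨ν, hνfin, hν⟩ := exists_measure_top_apply_eq_preimage μ hf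
  let φ : Measure X := ν.bind fun γ => μ.restrict (K γ)
  have hφ : ∀ A, MeasurableSet A → φ A = ∫⁻ γ, μ (A ∩ K γ) ∂ν := by
    intro A hA
    rw [Measure.bind_apply hA (Measurable.of_discrete).aemeasurable]
    simp_rw [Measure.restrict_apply hA]
  have hφμ : φ ≪ μ := by
    refine Measure.AbsolutelyContinuous.mk fun A hA h0 => ?_
    rw [hφ A hA]
    simp [measure_mono_null Set.inter_subset_left h0]
  have hφfin : IsFiniteMeasure φ := by
    refine ⟨?_⟩
    rw [hφ _ MeasurableSet.univ]
    refine (lintegral_mono fun γ => measure_mono (Set.subset_univ _)).trans_lt ?_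
    rw [lintegral_const]
    exact ENNReal.mul_lt_top (measure_lt_top _ _) (measure_lt_top _ _)
  let A₀ : Set X := {x | φ.rnDeriv μ x ≠ 0}
  have hA₀ : MeasurableSet A₀ :=
    (Measure.measurable_rnDeriv φ μ) (measurableSet_singleton 0).compl
  have hpos : ∀ A ⊆ A₀, MeasurableSet A → μ A ≠ 0 → φ A ≠ 0 := by
    intro A hA hAm hμA h0
    rw [← Measure.setLIntegral_rnDeriv hφμ, lintegral_eq_zero_iff (Measure.measurable_rnDeriv _ _),
      Filter.EventuallyEq, ae_restrict_iff' hAm] at h0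
    refine hμA (measure_mono_null (fun x hx => ?_) h0)
    simp only [Set.mem_compl_iff, Set.mem_ofPred_eq, Pi.zero_apply]
    exact fun h => hA hx (h hx)
  have hA₀pos : μ A₀ ≠ 0 := by
    intro h0
    have h1 : φ Set.univ = 0 := by
      rw [← Measure.setLIntegral_rnDeriv hφμ, Measure.restrict_univ,
        lintegral_eq_zero_iff (Measure.measurable_rnDeriv _ _)]
      exact h0
    rw [hφ _ MeasurableSet.univ, lintegral_eq_zero_iff Measurable.of_discrete] at h1
    have h2 : ν Set.univ = 0 := by
      refine measure_mono_null (fun γ _ => ?_) h1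
      simpa using hKpos γ
    rw [hν] at h2
    exact huniv h2
  -- A non-null `A` inside the support `A₀` of the density has `φ A ≠ 0`, so it cannot miss almost
  -- every `K γ`; two-valuedness then says it misses almost none.
  have hstep : ∀ A ⊆ A₀, MeasurableSet A → μ A ≠ 0 → μ (f ⁻¹' {γ | μ (A ∩ K γ) = 0}) = 0 := by
    intro A hA hAm hμA
    refine (htwo _).resolve_right fun h => hpos A hA hAm hμA ?_
    rw [hφ A hAm, lintegral_eq_zero_iff Measurable.of_discrete]
    rw [← hν] at h
    exact h
  let B : Finset Λ → Set X := fun s => A₀ ∩ ⋂ γ ∈ s, K γ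
  have hB : ∀ s, MeasurableSet (B s) := fun s =>
    hA₀.inter (s.measurableSet_biInter fun γ _ => (hKc γ).measurableSet)
  have hBmono : ∀ s t, s ⊆ t → B t ⊆ B s := fun s t hst =>
    Set.inter_subset_inter_right _ (Set.biInter_subset_biInter_left hst)
  have hchar : Order.IsOfFiniteCharacter
      {C : Set Λ | ∀ s : Finset Λ, ↑s ⊆ C → μ (B s) ≠ 0} := by
    intro C
    constructor
    · exact fun hC t ht _ s hs => hC s (hs.trans ht)
    · exact fun h s hs => h s hs s.finite_toSet s subset_rfl
  obtain ⟨C, -, hCmax⟩ := hchar.exists_maximal (x := ∅) (by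
    intro s hs
    have : s = ∅ := by simpa using hs
    subst this
    simpa [B] using hA₀pos)
  have hC := hCmax.prop
  -- If `C` were smaller, fewer than `#Λ` null sets of indices would be forbidden, and some new
  -- index could be added to `C`.
  have hcard : #Λ ≤ #C := by
    by_contra! hlt
    have hfin : #(Finset C) < #Λ := by
      rcases finite_or_infinite C with h | h
      · exact (lt_aleph0_of_finite _).trans_le (aleph0_le_mk Λ)
      · rwa [mk_finset_of_infinite]
    let emb : C ↪ Λ := Function.Embedding.subtype _
    have hembC : ∀ s : Finset C, (↑(s.map emb) : Set Λ) ⊆ C := by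
      intro s γ hγ
      simp only [Finset.coe_map, Set.mem_image] at hγ
      obtain ⟨δ, -, rfl⟩ := hγ
      exact δ.2
    have h1 := hadd (Finset C) (fun s => {γ | μ (B (s.map emb) ∩ K γ) = 0}) hfin fun s =>
      hstep _ Set.inter_subset_left (hB _) (hC _ (hembC s))
    have h2 : μ (f ⁻¹' (⋃ s : Finset C, {γ | μ (B (s.map emb) ∩ K γ) = 0}) ∪ f ⁻¹' C) = 0 :=
      measure_union_null h1 (hsmall C hlt)
    rw [← Set.preimage_union] at h2
    obtain ⟨x, hx⟩ := nonempty_of_measure_ne_zero (hconull _ h2)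
    simp only [Set.mem_preimage, Set.mem_compl_iff, Set.mem_union, not_or, Set.mem_iUnion,
      Set.mem_ofPred_eq, not_exists] at hx
    obtain ⟨hx1, hx2⟩ := hx
    refine hx2 (hCmax.le_of_ge (y := insert (f x) C) (fun s hs h0 => ?_)
      (Set.subset_insert _ _) (Set.mem_insert _ _))
    classical
    have hs' : (↑(s.erase (f x)) : Set Λ) ⊆ C := by
      intro γ hγ
      have hγ' := Finset.mem_erase.1 (Finset.mem_coe.1 hγ)
      exact (hs hγ'.2).resolve_left hγ'.1
    let t : Finset C := (s.erase (f x)).subtype (· ∈ C)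
    refine hx1 t (measure_mono_null ?_ h0)
    rintro y ⟨⟨hy0, hy⟩, hyx⟩
    refine ⟨hy0, Set.mem_iInter₂.2 fun γ hγ => ?_⟩
    by_cases hγx : γ = f x
    · rwa [hγx]
    · have hγe : γ ∈ s.erase (f x) := Finset.mem_erase.2 ⟨hγx, hγ⟩
      refine Set.mem_iInter₂.1 hy γ (Finset.mem_map.2 ⟨⟨γ, hs' hγe⟩, ?_, rfl⟩)
      exact Finset.mem_subtype.2 hγe
  have hCne : C.Nonempty := by
    rw [Set.nonempty_iff_ne_empty]
    rintro rfl
    simp at hcard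
  obtain ⟨γ₀, hγ₀⟩ := hCne
  obtain ⟨x, -, hx⟩ := (hKc γ₀).inter_iInter_nonempty (fun γ : C => K γ)
    (fun γ => (hKc γ).isClosed) (fun u => by
      classical
      have h1 : μ (B (insert γ₀ (u.map (Function.Embedding.subtype _)))) ≠ 0 := by
        refine hC _ ?_
        intro γ hγ
        simp only [Finset.coe_insert, Finset.coe_map, Set.mem_insert_iff, Set.mem_image] at hγ
        rcases hγ with rfl | ⟨δ, -, rfl⟩
        · exact hγ₀
        · exact δ.2
      obtain ⟨y, -, hy⟩ := nonempty_of_measure_ne_zero h1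
      rw [Set.mem_iInter₂] at hy
      refine ⟨y, hy γ₀ (Finset.mem_insert_self _ _), Set.mem_iInter₂.2 fun γ hγ => ?_⟩
      exact hy γ (Finset.mem_insert_of_mem (Finset.mem_map.2 ⟨γ, hγ, rfl⟩)))
  have hsub : C ⊆ Set.Iio (f x) := fun γ hγ => hKf γ (Set.mem_iInter.1 hx ⟨γ, hγ⟩)
  exact absurd (hcard.trans (mk_le_mk_of_subset hsub)) (not_le.2 (hΛ _))

open Cardinal in
/-- If `f` has measurable preimages of all sets, one of its fibres is not null. -/
theorem measure_eq_zero_of_forall_nullMeasurableSet_preimage {X : Type*} [TopologicalSpace X]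
    [T2Space X] [MeasurableSpace X] [BorelSpace X] (μ : Measure X) [IsFiniteMeasure μ]
    [μ.InnerRegularCompactLTTop] {I : Type u} {f : X → I}
    (hf : ∀ S, NullMeasurableSet (f ⁻¹' S) μ) (hfib : ∀ i, μ (f ⁻¹' {i}) = 0) : μ = 0 := by
  obtain ⟨κ, hκ⟩ : ∃ κ, #I = κ := ⟨_, rfl⟩
  induction κ using WellFoundedLT.induction generalizing I μ with
  | ind κ ih =>
  obtain ⟨e⟩ : Nonempty (I ≃ κ.ord.ToType) := Cardinal.eq.1 (by rw [hκ, mk_ord_toType])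
  by_contra hμ
  let _ : MeasurableSpace I := ⊤
  obtain ⟨ν, hνfin, hν⟩ := exists_measure_top_apply_eq_preimage μ hf
  obtain ⟨T, hT, hT2⟩ := exists_atom_of_forall_real ν fun h => by
    by_contra! hcon
    refine hμ (measure_eq_zero_of_forall_nullMeasurableSet_preimage_real (h := h ∘ f)
      (fun D => hf (h ⁻¹' D)) fun c => ?_)
    rw [Set.preimage_comp, ← hν]
    exact hcon c
  have hr : ∀ S, μ.restrict (f ⁻¹' T) (f ⁻¹' S) = ν (S ∩ T) := by
    intro S
    rw [Measure.restrict_apply₀' (hf T), hν, Set.preimage_inter]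
  have hac : ∀ E, μ.restrict E ≪ μ := fun E => Measure.absolutelyContinuous_of_le
    Measure.restrict_le_self
  have h0 : μ.restrict (f ⁻¹' T) = 0 := by
    refine measure_eq_zero_of_two_valued (f := e ∘ f) (fun i => by simpa using mk_Iio_lt i)
      (fun S => (hf (e ⁻¹' S)).mono_ac (hac _)) (fun S => ?_) (fun ι N hι hN => ?_) (fun i => ?_)
    · rw [Set.preimage_comp, Set.preimage_comp, hr, hr]
      rcases hT2 (e ⁻¹' S ∩ T) Set.inter_subset_right with h | h
      · exact Or.inl h
      · refine Or.inr (measure_mono_null (t := T \ (e ⁻¹' S ∩ T))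
          (fun x hx => ⟨hx.2, fun h => hx.1 h.1⟩) h)
    · by_contra hne
      have hιne : Nonempty ι := by
        by_contra h
        rw [not_nonempty_iff] at h
        simp at hne
      classical
      -- Choosing a piece containing each point gives a map to the smaller set `ι` with null fibres
      -- on the union, to which the induction hypothesis applies.
      let p : I → ι := fun i => if h : ∃ j, e i ∈ N j then h.choose else hιne.some
      have hp : ∀ i, e i ∈ ⋃ j, N j → e i ∈ N (p i) := by
        intro i hi
        have h := Set.mem_iUnion.1 hi
        simp only [p, dif_pos h]
        exact h.choose_spec
      rw [mk_ord_toType] at hι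
      refine hne (Measure.restrict_eq_zero.1 (ih #ι hι
        ((μ.restrict (f ⁻¹' T)).restrict ((e ∘ f) ⁻¹' ⋃ i, N i)) (f := p ∘ f)
        (fun S => ((hf (p ⁻¹' S)).mono_ac (hac _)).mono_ac
          (Measure.absolutelyContinuous_of_le Measure.restrict_le_self)) (fun j => ?_) rfl))
      have hnm : NullMeasurableSet ((e ∘ f) ⁻¹' ⋃ i, N i) (μ.restrict (f ⁻¹' T)) :=
        (hf (e ⁻¹' ⋃ i, N i)).mono_ac (hac _)
      rw [Measure.restrict_apply₀' hnm]
      refine measure_mono_null ?_ (hN j)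
      rintro x ⟨rfl, hx⟩
      exact hp _ hx
    · rw [Set.preimage_comp]
      refine Measure.restrict_le_self.absolutelyContinuous ?_
      have : e ⁻¹' {i} = {e.symm i} := by
        ext j
        simp [Equiv.eq_symm_apply]
      rw [this]
      exact hfib _
  rw [Measure.restrict_eq_zero, ← hν] at h0
  exact hT h0

/-! ### Maps into metric spaces -/

theorem exists_ball_preimage_ne_zero {X M : Type*} [TopologicalSpace X]
    [T2Space X] [MeasurableSpace X] [BorelSpace X] {μ : Measure X} [IsFiniteMeasure μ]
    [μ.InnerRegularCompactLTTop] [PseudoMetricSpace M] {F : X → M}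
    (hF : ∀ C, IsClosed C → NullMeasurableSet (F ⁻¹' C) μ) (hμ : μ ≠ 0) {ε : ℝ} (hε : 0 < ε) :
    ∃ y, μ (F ⁻¹' Metric.ball y ε) ≠ 0 := by
  by_contra! hball
  let r : M → M → Prop := WellOrderingRel
  have hwf : WellFounded r := WellOrderingRel.isWellOrder.toIsWellFounded.wf
  -- The margin 1/(n+1) keeps pieces with distinct centres that far apart, so arbitrary unions of
  -- them are closed.
  let E : ℕ → M → Set M := fun n i =>
    {z | dist z i ≤ ε - 1 / ((n : ℝ) + 1) ∧ ∀ j, r j i → ε ≤ dist z j}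
  have hδ : ∀ n : ℕ, 0 < 1 / ((n : ℝ) + 1) := fun n => Nat.one_div_pos_of_nat
  have hEclosed : ∀ n i, IsClosed (E n i) := by
    intro n i
    have h1 : IsClosed {z : M | dist z i ≤ ε - 1 / ((n : ℝ) + 1)} :=
      isClosed_le (by fun_prop) (by fun_prop)
    refine h1.inter ?_
    have : {z : M | ∀ j, r j i → ε ≤ dist z j} = ⋂ (j) (_ : r j i), {z | ε ≤ dist z j} := by
      ext z
      simp
    change IsClosed {z : M | ∀ j, r j i → ε ≤ dist z j}
    rw [this]
    exact isClosed_iInter fun j => isClosed_iInter fun _ => isClosed_le (by fun_prop) (by fun_prop)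
  have hsep : ∀ n i j w w', w ∈ E n i → w' ∈ E n j → r i j → 1 / ((n : ℝ) + 1) ≤ dist w w' := by
    intro n i j w w' hw hw' hij
    have h1 := hw'.2 i hij
    have h2 := hw.1
    have h3 := dist_triangle_left w' i w
    linarith
  have hEunion : ∀ n (S : Set M), IsClosed (⋃ i : S, E n i) := by
    intro n S
    refine LocallyFinite.isClosed_iUnion (fun z => ⟨Metric.ball z (1 / ((n : ℝ) + 1) / 2),
      Metric.ball_mem_nhds _ (half_pos (hδ n)), Set.Subsingleton.finite ?_⟩) fun i => hEclosed n i
    rintro i ⟨w, hwi, hwz⟩ j ⟨w', hwj, hwz'⟩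
    rw [Metric.mem_ball] at hwz hwz'
    have hlt : dist w w' < 1 / ((n : ℝ) + 1) := by
      have := dist_triangle_right w w' z
      linarith
    rcases trichotomous_of r i.1 j.1 with h | h | h
    · exact absurd (hsep n _ _ _ _ hwi hwj h) (not_le.2 hlt)
    · exact Subtype.ext h
    · rw [dist_comm] at hlt
      exact absurd (hsep n _ _ _ _ hwj hwi h) (not_le.2 hlt)
  have hne : ∀ t, {i | dist (F t) i < ε}.Nonempty := fun t => ⟨F t, by simpa using hε⟩
  let f : X → M := fun t => hwf.min {i | dist (F t) i < ε} (hne t)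
  have hf : ∀ t, dist (F t) (f t) < ε := fun t => hwf.min_mem _ (hne t)
  have hfmin : ∀ t j, r j (f t) → ε ≤ dist (F t) j := by
    intro t j hj
    by_contra! h
    exact hwf.not_lt_min _ h hj
  have hfeq : ∀ n t i, F t ∈ E n i → f t = i := by
    intro n t i hi
    rcases trichotomous_of r (f t) i with h | h | h
    · exact absurd (hi.2 _ h) (not_le.2 (hf t))
    · exact h
    · have h1 := hfmin t i h
      have h2 := hi.1
      have h3 := hδ n
      linarith
  let Xn : ℕ → Set X := fun n => F ⁻¹' ⋃ i : (Set.univ : Set M), E n i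
  have hcover : ⋃ n, Xn n = Set.univ := by
    refine Set.eq_univ_of_forall fun t => ?_
    obtain ⟨n, hn⟩ := exists_nat_one_div_lt (sub_pos.2 (hf t))
    refine Set.mem_iUnion.2 ⟨n, Set.mem_iUnion.2 ⟨⟨f t, trivial⟩, ?_, hfmin t⟩⟩
    change dist (F t) (f t) ≤ _
    linarith
  refine hμ (Measure.measure_univ_eq_zero.1 ?_)
  rw [← hcover]
  refine measure_iUnion_null fun n => Measure.restrict_eq_zero.1 ?_
  have hXn : NullMeasurableSet (Xn n) μ := hF _ (hEunion n _)
  refine measure_eq_zero_of_forall_nullMeasurableSet_preimage _ (f := f) (fun S => ?_) fun i => ?_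
  · refine ((hF _ (hEunion n S)).mono_ac
      (Measure.absolutelyContinuous_of_le Measure.restrict_le_self)).congr ?_
    rw [Filter.eventuallyEq_set]
    filter_upwards [ae_restrict_mem₀ hXn] with t ht
    obtain ⟨⟨i, _⟩, hi⟩ := Set.mem_iUnion.1 ht
    constructor
    · intro h
      obtain ⟨⟨j, hjS⟩, hj⟩ := Set.mem_iUnion.1 h
      rw [Set.mem_preimage, hfeq n t j hj]
      exact hjS
    · intro h
      rw [Set.mem_preimage, hfeq n t i hi] at h
      exact Set.mem_iUnion.2 ⟨⟨i, h⟩, hi⟩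
  · refine Measure.restrict_le_self.absolutelyContinuous (measure_mono_null ?_ (hball i))
    rintro t rfl
    exact hf t

/-! ### Haar measurability and unitary representations -/

theorem HaarMeasurableSet.nullMeasurableSet_restrict {G : Type*} [MeasurableSpace G]
    {μ : Measure G} {s K : Set G} (hs : HaarMeasurableSet μ s) (hK : MeasurableSet K)
    (hKfin : μ K ≠ ⊤) : NullMeasurableSet s (μ.restrict K) := by
  have hfin : μ (s ∩ K) ≠ ⊤ := measure_ne_top_of_subset Set.inter_subset_right hKfin
  let T := toMeasurable μ (s ∩ K)
  have hTK : s ∩ K ⊆ T ∩ K :=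
    Set.subset_inter (subset_toMeasurable _ _) Set.inter_subset_right
  have h1 : μ (T ∩ K) ≤ μ (s ∩ K) :=
    (measure_mono Set.inter_subset_left).trans (measure_toMeasurable _).le
  -- Carathéodory's condition is tested on a measurable hull of `s ∩ K`; finiteness lets the measure
  -- cancel, so the excess is null.
  have h2 : μ (T ∩ K) = μ (T ∩ K ∩ s) + μ ((T ∩ K) \ s) := hs (T ∩ K)
  have h3 : μ ((T ∩ K) \ s) = 0 := by
    have h4 : μ (s ∩ K) ≤ μ (T ∩ K ∩ s) :=
      measure_mono fun x hx => ⟨hTK hx, hx.1⟩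
    have h5 : μ (s ∩ K) + μ ((T ∩ K) \ s) ≤ μ (s ∩ K) + 0 := by
      rw [add_zero]
      exact (add_le_add_left h4 _).trans (h2.symm.trans_le h1)
    exact le_antisymm ((ENNReal.add_le_add_iff_left hfin).1 h5) zero_le
  refine NullMeasurableSet.congr (measurableSet_toMeasurable μ (s ∩ K)).nullMeasurableSet ?_
  have h6 : ∀ᵐ t ∂μ.restrict K, t ∉ (T ∩ K) \ s :=
    Measure.restrict_le_self.absolutelyContinuous (measure_eq_zero_iff_ae_notMem.1 h3)
  rw [Filter.eventuallyEq_set]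
  filter_upwards [ae_restrict_mem hK, h6] with t htK ht
  constructor
  · intro h
    by_contra hts
    exact ht ⟨⟨h, htK⟩, hts⟩
  · exact fun h => subset_toMeasurable _ _ ⟨h, htK⟩

section

variable {G H : Type*} [Group G] [NormedAddCommGroup H] [InnerProductSpace ℂ H] [CompleteSpace H]

theorem unitaryRep_norm_sub_inv (U : G →* unitary (H →L[ℂ] H)) (t : G) (x z : H) :
    ‖(U t⁻¹ : H →L[ℂ] H) x - z‖ = ‖x - (U t : H →L[ℂ] H) z‖ := by
  rw [← Unitary.norm_map (U t), map_sub]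
  congr 2
  rw [← mul_apply_eq_comp, ← Submonoid.coe_mul, ← map_mul]
  simp

theorem WeaklyOperatorMeasurable.haarMeasurableSet_inv_apply [MeasurableSpace G] {μ : Measure G}
    {U : G →* unitary (H →L[ℂ] H)} (hU : WeaklyOperatorMeasurable μ U) (x : H) {O : Set H}
    (hO : IsOpen O) : HaarMeasurableSet μ ((fun t => (U t⁻¹ : H →L[ℂ] H) x) ⁻¹' O) := by
  -- The bound comes from ‖x - Tz‖² = 2‖x‖² - 2 Re⟨x, Tz⟩ when T is unitary and ‖z‖ = ‖x‖.
  let V : Set (H →WOT[ℂ] H) := ⋃ (z : H) (r : ℝ)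
    (_ : ‖z‖ = ‖x‖ ∧ 0 < r ∧ Metric.ball z r ⊆ O),
      {T | ‖x‖ ^ 2 - r ^ 2 / 2 < (inner ℂ x (T z)).re}
  have hV : IsOpen V := isOpen_iUnion fun z => isOpen_iUnion fun r => isOpen_iUnion fun _ =>
    isOpen_lt continuous_const
      (Complex.continuous_re.comp (ContinuousLinearMapWOT.continuous_inner_apply continuous_id z x))
  have hnear : ∀ (t : G) (z : H) (r : ℝ), ‖z‖ = ‖x‖ → 0 < r →
      (‖(U t⁻¹ : H →L[ℂ] H) x - z‖ < r ↔
        ‖x‖ ^ 2 - r ^ 2 / 2 < (inner ℂ x ((U t : H →L[ℂ] H) z)).re) := by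
    intro t z r hz hr
    have h1 := norm_sub_sq (𝕜 := ℂ) x ((U t : H →L[ℂ] H) z)
    rw [Unitary.norm_map, hz] at h1
    change _ = _ - 2 * (inner ℂ x ((U t : H →L[ℂ] H) z)).re + _ at h1
    rw [unitaryRep_norm_sub_inv, ← sq_lt_sq₀ (norm_nonneg _) hr.le, h1]
    constructor <;> intro h <;> linarith
  convert hU V hV using 1
  ext t
  simp only [V, Set.mem_preimage, Set.mem_iUnion, Set.mem_ofPred_eq, exists_prop,
    ContinuousLinearMapWOT.ofCLM_apply]
  constructor
  · intro h
    obtain ⟨r, hr, hball⟩ := Metric.isOpen_iff.1 hO _ h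
    have hz : ‖(U t⁻¹ : H →L[ℂ] H) x‖ = ‖x‖ := Unitary.norm_map (U t⁻¹) x
    exact ⟨_, r, ⟨hz, hr, hball⟩, (hnear t _ r hz hr).1 (by simpa using hr)⟩
  · rintro ⟨z, r, ⟨hz, hr, hball⟩, h⟩
    refine hball ?_
    rw [Metric.mem_ball, dist_eq_norm]
    exact (hnear t z r hz hr).2 h

theorem isContinuousRep_of_forall_nhds_one [TopologicalSpace G] [IsTopologicalGroup G]
    (U : G →* unitary (H →L[ℂ] H))
    (h : ∀ (x : H) (ε : ℝ), 0 < ε → ∀ᶠ g in nhds (1 : G), ‖(U g : H →L[ℂ] H) x - x‖ < ε) :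
    IsContinuousRep U := by
  intro x y
  refine Continuous.inner continuous_const (continuous_iff_continuousAt.2 fun s => ?_)
  rw [ContinuousAt, Metric.tendsto_nhds]
  intro ε hε
  have h1 : Filter.Tendsto (fun t => s⁻¹ * t) (nhds s) (nhds (1 : G)) := by
    have : Continuous fun t : G => s⁻¹ * t := by fun_prop
    simpa using this.tendsto s
  filter_upwards [h1.eventually (h x ε hε)] with t ht
  have h2 : (U t : H →L[ℂ] H) x = (U s : H →L[ℂ] H) ((U (s⁻¹ * t) : H →L[ℂ] H) x) := by
    rw [← mul_apply_eq_comp, ← Submonoid.coe_mul, ← map_mul, mul_inv_cancel_left]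
  rwa [dist_eq_norm, h2, ← map_sub, Unitary.norm_map]

end

theorem theorem1 {G : Type*} [Group G] [TopologicalSpace G] [IsTopologicalGroup G]
    [LocallyCompactSpace G] [T2Space G] [MeasurableSpace G] [BorelSpace G]
    (μ : Measure G) [μ.IsHaarMeasure] [μ.Regular]
    {H : Type*} [NormedAddCommGroup H] [InnerProductSpace ℂ H] [CompleteSpace H]
    (U : G →* unitary (H →L[ℂ] H)) (hU : WeaklyOperatorMeasurable μ U) :
    IsContinuousRep U := by
  refine isContinuousRep_of_forall_nhds_one U fun x ε hε => ?_
  obtain ⟨K, hK, hK1⟩ := exists_compact_mem_nhds (1 : G)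
  have hKpos : μ.restrict K ≠ 0 := fun h =>
    (Measure.measure_pos_of_mem_nhds μ hK1).ne' (Measure.restrict_eq_zero.1 h)
  have hKfin : μ K ≠ ⊤ := hK.measure_ne_top
  have : IsFiniteMeasure (μ.restrict K) := isFiniteMeasure_restrict.2 hKfin
  have hF : ∀ C : Set H, IsClosed C →
      NullMeasurableSet ((fun t => (U t⁻¹ : H →L[ℂ] H) x) ⁻¹' C) (μ.restrict K) := by
    intro C hC
    have h := (hU.haarMeasurableSet_inv_apply x hC.isOpen_compl).nullMeasurableSet_restrict
      hK.measurableSet hKfin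
    simpa using h.compl
  obtain ⟨y, hy⟩ := exists_ball_preimage_ne_zero hF hKpos (half_pos hε)
  have hA : NullMeasurableSet ((fun t => (U t⁻¹ : H →L[ℂ] H) x) ⁻¹' Metric.ball y (ε / 2))
      (μ.restrict K) := by
    simpa using (hF _ Metric.isOpen_ball.isClosed_compl).compl
  obtain ⟨B, hBA, hB, hae⟩ := hA.exists_measurable_subset_ae_eq
  rw [← measure_congr hae, Measure.restrict_apply hB] at hy
  -- Steinhaus: for a, b in the set, U(a⁻¹)x and U(b⁻¹)x lie in one ball of radius ε/2, so U(a/b)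
  -- moves x by less than ε.
  have hnhds := Measure.div_mem_nhds_one_of_haar_pos_ne_top μ (B ∩ K) (hB.inter hK.measurableSet)
    (pos_iff_ne_zero.2 hy) (measure_ne_top_of_subset Set.inter_subset_right hKfin)
  filter_upwards [hnhds] with g hg
  obtain ⟨a, ha, b, hb, rfl⟩ := Set.mem_div.1 hg
  have ha' := hBA ha.1
  have hb' := hBA hb.1
  simp only [Set.mem_preimage, Metric.mem_ball] at ha' hb'
  have h1 : (U (a / b) : H →L[ℂ] H) x = (U a : H →L[ℂ] H) ((U b⁻¹ : H →L[ℂ] H) x) := by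
    rw [← mul_apply_eq_comp, ← Submonoid.coe_mul, ← map_mul, div_eq_mul_inv]
  rw [h1, norm_sub_rev, ← unitaryRep_norm_sub_inv, ← dist_eq_norm]
  have := dist_triangle_right ((U a⁻¹ : H →L[ℂ] H) x) ((U b⁻¹ : H →L[ℂ] H) x) y
  linarith
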